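/- Let $\mathbb E_0$ be the relation of eventual equality on $2^\omega$: $\eta\mathrel{\mathbb E_0}\nu$ iff there is $n$ with $\eta(m)=\nu(m)$ for all $m>n$. A topological space is *strong Choquet* if player B has a winning strategy in the following game: in round $n$ player A plays an open set $U_n\subseteq V_{n-1}$ (where $V_{-1}=X$) and a point $x_n\in U_n$, player B answers with an open set $V_n$ such that $x_n\in V_n\subseteq U_n$, and B wins iff $\bigcap_n V_n\neq\emptyset$. For a group $\Gamma$ of homeomorphisms of $X$, $\Delta\subseteq\Gamma$ and $A\subseteq X$ write $\Delta\cdot A=\bigcup_{\gamma\in\Delta}\gamma\cdot A$, and $\Gamma\cdot x=\Gamma\cdot\{x\}$. **Theorem.** Let $X$ be a regular strong Choquet space (not necessarily Hausdorff), $\Gamma$ a group of homeomorphisms of $X$, and $Y\subseteq X$ a $\Gamma$-invariant set. Let $\mathcal U$ be the family of open sets $U\subseteq X$ for which there is no finite $\Delta\subseteq\Gamma$ with $Y\subseteq\Delta\cdot U$, and let $\mathcal I_{\mathcal U}$ be the ideal of all $F\subseteq X$ such that for every $U\in\mathcal U$ there is an open $V\supseteq F$ with $V\cup U\in\mathcal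 U$. Let $(R_n)_{n\in\mathbb N}$ be an increasing sequence of reflexive symmetric closed subsets of $X\times X$, and write $R_n^{(4)}=R_n\circ R_n\circ R_n\circ R_n$. Suppose that $K\subseteq X$ is compact, $K\notin\mathcal I_{\mathcal U}$, and (a) for all $n\in\mathbb N$ and $x\in K$ there is $\gamma\in\Gamma$ with $(x,\gamma\cdot x)\notin R_n^{(4)}$; (b) for all $\gamma\in\Gamma$ there is $n\in\mathbb N$ such that $(x,\gamma\cdot x)\in R_n$ for all $x\in\Gamma\cdot K$. Then there is a map $\varphi:2^\omega\to\mathcal P(X)$ such that for all $y,z\in2^\omega$: 1. $\varphi(y)$ is a nonempty closed $G_\delta$ subset of $X$; 2. if $z\mathrel{\mathbb E_0}y$, then $\gamma\cdot\varphi(z)=\varphi(y)$ for some $\gamma\in\Gamma$; 3. if $z$ and $y$ are not $\mathbb E_0$-equivalent, then $\varphi(y)\times\varphi(z)$ is disjoint from $\bigcup_n R_n$. In particular, there is a map $f:2^\omega\to X$ with $f(y)\in\varphi(y)$ for all $y$, which sends $\mathbb E_0$-equivalent points to points of the same $\Gamma$-orbit and $\mathbb E_0$-inequivalent points to pairs outside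 $\bigcup_n R_n$. Moreover, if $X$ is compact, then there is $x\in K$ such that the map $\psi(y)=\varphi(y)\cap\overline{\Gamma\cdot x}$ takes nonempty closed values (which are $G_\delta$ relative to $\overline{\Gamma\cdot x}$) and satisfies 2 and 3 in place of $\varphi$, and there is a map $f:2^\omega\to\overline{\Gamma\cdot x}$ which sends $\mathbb E_0$-equivalent points to points of the same $\Gamma$-orbit and $\mathbb E_0$-inequivalent points to pairs outside $\bigcup_n R_n$. -/

import Mathlib

open scoped SetRel

/-- The relation `𝔼₀` of eventual equality on the Cantor space `2^ω`. -/
def EZero (η ν : ℕ → Bool) : Prop :=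
  ∃ n, ∀ m, n < m → η m = ν m

section Games

variable {X : Type*} [TopologicalSpace X]

/-- A strategy for player B in the strong Choquet game: it answers a finite list of moves
`(U₀, x₀), …, (Uₙ, xₙ)` of player A (an open set together with a point) by an open set. -/
abbrev ChoquetStrategy (X : Type*) [TopologicalSpace X] : Type _ :=
  List (TopologicalSpace.Opens X × X) → TopologicalSpace.Opens X

/-- The open set `Vₙ` that player B plays in round `n` when following the strategy `σ` while
player A's moves are `a 0, a 1, …`. -/
def ChoquetStrategy.response (σ : ChoquetStrategy X) (a : ℕ → TopologicalSpace.Opens X × X)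
    (n : ℕ) : TopologicalSpace.Opens X :=
  σ ((List.range (n + 1)).map a)

/-- Player A's move `(Uₙ, xₙ)` in round `n` obeys the rules of the strong Choquet game:
`xₙ ∈ Uₙ` and `Uₙ ⊆ Vₙ₋₁`, where `V₋₁ = X`. -/
def ChoquetStrategy.LegalA (σ : ChoquetStrategy X) (a : ℕ → TopologicalSpace.Opens X × X)
    (n : ℕ) : Prop :=
  (a n).2 ∈ (a n).1 ∧ ∀ m, m + 1 = n → (a n).1 ≤ σ.response a m

/-- Player B's answer `Vₙ` in round `n` obeys the rules of the strong Choquet game: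
`xₙ ∈ Vₙ ⊆ Uₙ`. -/
def ChoquetStrategy.LegalB (σ : ChoquetStrategy X) (a : ℕ → TopologicalSpace.Opens X × X)
    (n : ℕ) : Prop :=
  (a n).2 ∈ σ.response a n ∧ σ.response a n ≤ (a n).1

/-- `σ` is a winning strategy for player B: as long as player A obeys the rules, so does B,
and if A obeys the rules in all rounds, then `⋂ₙ Vₙ` is nonempty. -/
def ChoquetStrategy.IsWinning (σ : ChoquetStrategy X) : Prop :=
  ∀ a : ℕ → TopologicalSpace.Opens X × X,
    (∀ n, (∀ k ≤ n, σ.LegalA a k) → σ.LegalB a n) ∧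
    ((∀ n, σ.LegalA a n) → (⋂ n, (σ.response a n : Set X)).Nonempty)

/-- `X` is a strong Choquet space: player B has a winning strategy in the strong Choquet game. -/
def IsStrongChoquet (X : Type*) [TopologicalSpace X] : Prop :=
  ∃ σ : ChoquetStrategy X, σ.IsWinning

end Games

section Translates

variable {X : Type*} [TopologicalSpace X]

/-- `Δ · A`, the union of the translates `γ · A` for `γ ∈ Δ`. -/
def translates (Δ : Set (X ≃ₜ X)) (A : Set X) : Set X :=
  ⋃ γ ∈ Δ, γ '' A

/-- The family of open sets `U` such that no finitely many `Γ`-translates of `U` cover `Y`. -/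
def nonCovering (Γ : Subgroup (X ≃ₜ X)) (Y : Set X) : Set (Set X) :=
  {U | IsOpen U ∧
    ¬ ∃ Δ : Set (X ≃ₜ X), Δ.Finite ∧ Δ ⊆ (Γ : Set (X ≃ₜ X)) ∧ Y ⊆ translates Δ U}

/-- The ideal associated with a family `𝒰` of open sets: `F` belongs to it iff every `U ∈ 𝒰` has
an open `V ⊇ F` with `V ∪ U ∈ 𝒰`. -/
def associatedIdeal (𝒰 : Set (Set X)) : Set (Set X) :=
  {F | ∀ U ∈ 𝒰, ∃ V, IsOpen V ∧ F ⊆ V ∧ V ∪ U ∈ 𝒰}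

end Translates

open Set Topology

/-! ### The ideal and its support points -/

section Ideal

variable {X : Type*} [TopologicalSpace X]

/-! The sets `φ y` are the outcomes of strong Choquet games played along all branches of a Cantor
scheme. Round n has one open set `U n`, one point `x n` in K and one γ n in Γ. Branch y sees them
translated by the product `G n y` of those γ (k + 1), k < n, with `y k = true`, and `φ y` is the
intersection of the sets `G n y '' U n`. Since new factors enter on the right, branches with the
same tail eventually differ by a fixed left factor, so Γ moves one intersection onto the other. The
winning strategy makes the intersections nonempty, and nested closures make them closed.

For inequivalent branches, each coordinate m at which they differ must push them outside `R m`. This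
needs γ with `s u` and `t (γ v)` not `R m`-related for all u, v in the new open set and all of the
finitely many earlier products s, t, while both the new set and its γ-translate stay inside a
prescribed neighbourhood of `x m`. `IsSupportPoint.exists_far_translate` supplies it. Its core,
`exists_far_translate`, is a covering argument: if elements of Γ could not return a point of a
positive compact set to its neighbourhood without remaining close to it, then (a) would move each
point off all translates of that neighbourhood used in a cover of Y. Near the set, Y would be
covered by translates of a noncovering U alone, which is absurd. Of the four factors in `R n ○ R n ○
R n ○ R n`, one absorbs a covering translate and two absorb s and t. -/

theorem associatedIdeal_mono {𝒰 : Set (Set X)} {F G : Set X} (h : F ⊆ G)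
    (hG : G ∈ associatedIdeal 𝒰) : F ∈ associatedIdeal 𝒰 := fun U hU => by
  obtain ⟨V, hV, hGV, hVU⟩ := hG U hU
  exact ⟨V, hV, h.trans hGV, hVU⟩

theorem empty_mem_associatedIdeal (𝒰 : Set (Set X)) : ∅ ∈ associatedIdeal 𝒰 := fun U hU =>
  ⟨∅, isOpen_empty, Subset.rfl, by rwa [empty_union]⟩

theorem union_mem_associatedIdeal {𝒰 : Set (Set X)} {F G : Set X}
    (hF : F ∈ associatedIdeal 𝒰) (hG : G ∈ associatedIdeal 𝒰) :
    F ∪ G ∈ associatedIdeal 𝒰 := fun U hU => by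
  obtain ⟨V, hV, hFV, hVU⟩ := hF U hU
  obtain ⟨W, hW, hGW, hWU⟩ := hG _ hVU
  refine ⟨W ∪ V, hW.union hV, union_subset (hFV.trans subset_union_right)
    (hGW.trans subset_union_left), ?_⟩
  rwa [union_assoc]

/-- A point at which the compact set `K` is locally outside of the ideal. -/
def IsSupportPoint (𝒰 : Set (Set X)) (K : Set X) (x : X) : Prop :=
  ∀ W, IsOpen W → x ∈ W → K ∩ W ∉ associatedIdeal 𝒰

theorem IsSupportPoint.mono {𝒰 : Set (Set X)} {F K : Set X} {x : X} (h : F ⊆ K)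
    (hx : IsSupportPoint 𝒰 F x) : IsSupportPoint 𝒰 K x := fun W hW hxW hK =>
  hx W hW hxW (associatedIdeal_mono (inter_subset_inter_left _ h) hK)

/-- Otherwise finitely many neighbourhoods with trace in the ideal cover K. -/
theorem exists_isSupportPoint {𝒰 : Set (Set X)} {K : Set X} (hK : IsCompact K)
    (hpos : K ∉ associatedIdeal 𝒰) : ∃ x ∈ K, IsSupportPoint 𝒰 K x := by
  by_contra! hcon
  apply hpos
  have : K ∩ K ∈ associatedIdeal 𝒰 := by
    refine hK.induction_on (p := fun s => K ∩ s ∈ associatedIdeal 𝒰) ?_ ?_ ?_ ?_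
    · simpa using empty_mem_associatedIdeal 𝒰
    · exact fun s t hst ht => associatedIdeal_mono (inter_subset_inter_right _ hst) ht
    · intro s t hs ht
      rw [inter_union_distrib_left]
      exact union_mem_associatedIdeal hs ht
    · intro x hx
      have hns := hcon x hx
      simp only [IsSupportPoint, not_forall, not_not] at hns
      obtain ⟨W, hW, hxW, hKW⟩ := hns
      exact ⟨W, mem_nhdsWithin_of_mem_nhds (hW.mem_nhds hxW), hKW⟩
  rwa [inter_self] at this

/-- Discarding an open superset of `A`, rather than `A` itself, leaves a compact remainder when `F`
is compact, so that it has a support point. -/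
theorem exists_open_diff_notMem_associatedIdeal {𝒰 : Set (Set X)} {F A : Set X}
    (hF : F ∉ associatedIdeal 𝒰) (hA : A ∈ associatedIdeal 𝒰) :
    ∃ V, IsOpen V ∧ A ⊆ V ∧ F \ V ∉ associatedIdeal 𝒰 := by
  by_contra! hcon
  refine hF fun U hU => ?_
  obtain ⟨V, hV, hAV, hVU⟩ := hA U hU
  obtain ⟨W, hW, hFW, hWU⟩ := hcon V hV hAV _ hVU
  refine ⟨W ∪ V, hW.union hV, ?_, by rwa [union_assoc]⟩
  intro x hx
  by_cases hxV : x ∈ V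
  · exact Or.inr hxV
  · exact Or.inl (hFW ⟨hx, hxV⟩)

end Ideal

/-! ### Moving points far while returning to a neighbourhood -/

section Translates

variable {X : Type*} [TopologicalSpace X]

theorem mem_translates {Δ : Set (X ≃ₜ X)} {A : Set X} {z : X} :
    z ∈ translates Δ A ↔ ∃ γ ∈ Δ, ∃ a ∈ A, γ a = z := by
  simp [translates]

theorem isClosed_translates {Δ : Set (X ≃ₜ X)} (hΔ : Δ.Finite) {A : Set X} (hA : IsClosed A) :
    IsClosed (translates Δ A) :=
  hΔ.isClosed_biUnion fun γ _ => γ.isClosedMap _ hA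

theorem apply_mem_translates {Γ : Subgroup (X ≃ₜ X)} {K : Set X} {γ : X ≃ₜ X} (hγ : γ ∈ Γ)
    {x : X} (hx : x ∈ translates (Γ : Set (X ≃ₜ X)) K) :
    γ x ∈ translates (Γ : Set (X ≃ₜ X)) K := by
  obtain ⟨δ, hδ, a, ha, rfl⟩ := mem_translates.1 hx
  exact mem_translates.2 ⟨γ * δ, Γ.mul_mem hγ hδ, a, ha, rfl⟩

theorem subset_translates (Γ : Subgroup (X ≃ₜ X)) (K : Set X) :
    K ⊆ translates (Γ : Set (X ≃ₜ X)) K := fun x hx =>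
  mem_translates.2 ⟨1, Γ.one_mem, x, hx, rfl⟩

theorem image_closure_translates {Γ : Subgroup (X ≃ₜ X)} {K : Set X} {γ : X ≃ₜ X} (hγ : γ ∈ Γ) :
    γ '' closure (translates (Γ : Set (X ≃ₜ X)) K) =
      closure (translates (Γ : Set (X ≃ₜ X)) K) := by
  rw [γ.image_closure]
  congr 1
  ext z
  constructor
  · rintro ⟨x, hx, rfl⟩
    exact apply_mem_translates hγ hx
  · intro hz
    exact ⟨γ⁻¹ z, apply_mem_translates (Γ.inv_mem hγ) hz, γ.apply_symm_apply z⟩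

/-- Finitely many elements of the group move the points of `Γ · K` within a single `R n`. -/
theorem exists_uniform_bound {Γ : Subgroup (X ≃ₜ X)} {K : Set X} {R : ℕ → SetRel X X}
    (hRmono : Monotone R)
    (hb : ∀ γ ∈ Γ, ∃ n, ∀ x ∈ translates (Γ : Set (X ≃ₜ X)) K, (x, γ x) ∈ R n)
    {Δ : Set (X ≃ₜ X)} (hΔ : Δ.Finite) (hΔΓ : Δ ⊆ Γ) (m : ℕ) :
    ∃ n, m ≤ n ∧ ∀ δ ∈ Δ, ∀ x ∈ translates (Γ : Set (X ≃ₜ X)) K, (x, δ x) ∈ R n := by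
  choose! N hN using hb
  obtain ⟨n, hn⟩ := (hΔ.image N).bddAbove
  refine ⟨max m n, le_max_left _ _, fun δ hδ x hx => ?_⟩
  exact hRmono ((hn (mem_image_of_mem N hδ)).trans (le_max_right _ _)) (hN δ (hΔΓ hδ) x hx)

theorem translates_union (Δ : Set (X ≃ₜ X)) (A B : Set X) :
    translates Δ (A ∪ B) = translates Δ A ∪ translates Δ B := by
  ext z
  simp only [mem_translates, mem_union, or_and_right, exists_or, and_or_left]

/-- The covering argument: a counterexample would let finitely many translates of a noncovering set
cover Y. -/
theorem exists_far_translate {Γ : Subgroup (X ≃ₜ X)} {Y : Set X} (hY : ∀ γ ∈ Γ, γ '' Y = Y)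
    {R : ℕ → SetRel X X} (hRmono : Monotone R) {K : Set X}
    (ha : ∀ n, ∀ x ∈ K, ∃ γ ∈ Γ, (x, γ x) ∉ R n ○ R n ○ R n ○ R n)
    (hb : ∀ γ ∈ Γ, ∃ n, ∀ x ∈ translates (Γ : Set (X ≃ₜ X)) K, (x, γ x) ∈ R n)
    {F : Set X} (hF : IsCompact F) (hFK : F ⊆ K) (hFpos : F ∉ associatedIdeal (nonCovering Γ Y))
    {V D : Set X} (hV : IsOpen V) (hFV : F ⊆ V) (hD : IsClosed D) (hVD : V ⊆ D) (m : ℕ) :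
    ∃ x ∈ F, ∃ γ ∈ Γ, γ x ∈ D ∧ (x, γ x) ∉ R m ○ R m ○ R m := by
  by_contra! hcon
  have hYmem : ∀ γ ∈ Γ, ∀ y ∈ Y, γ y ∈ Y := fun γ hγ y hy => hY γ hγ ▸ mem_image_of_mem γ hy
  simp only [associatedIdeal, mem_ofPred_eq, not_forall, not_exists, not_and] at hFpos
  obtain ⟨U, hU, hFU⟩ := hFpos
  have cover : ∀ V, IsOpen V → F ⊆ V →
      ∃ Δ : Set (X ≃ₜ X), Δ.Finite ∧ Δ ⊆ (Γ : Set (X ≃ₜ X)) ∧ Y ⊆ translates Δ (V ∪ U) := by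
    intro V hV hFV
    by_contra hno
    exact hFU V hV hFV ⟨hV.union hU.1, hno⟩
  obtain ⟨Δ, hΔ, hΔΓ, hYΔ⟩ := cover V hV hFV
  -- Only after `Δ` is known can k be chosen; (a) is applied at this k.
  obtain ⟨k, hmk, hk⟩ := exists_uniform_bound hRmono hb hΔ hΔΓ m
  have key : ∃ V' : Set X, IsOpen V' ∧ F ⊆ V' ∧ ∃ Δ' : Set (X ≃ₜ X), Δ'.Finite ∧
      Δ' ⊆ (Γ : Set (X ≃ₜ X)) ∧ V' ∩ Y ⊆ translates Δ' U := by
    refine hF.induction_on (p := fun s => ∃ V' : Set X, IsOpen V' ∧ s ⊆ V' ∧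
      ∃ Δ' : Set (X ≃ₜ X), Δ'.Finite ∧ Δ' ⊆ (Γ : Set (X ≃ₜ X)) ∧ V' ∩ Y ⊆ translates Δ' U)
      ?_ ?_ ?_ ?_
    · exact ⟨∅, isOpen_empty, Subset.rfl, ∅, finite_empty, empty_subset _, by simp⟩
    · rintro s t hst ⟨V', hV', htV', h⟩
      exact ⟨V', hV', hst.trans htV', h⟩
    · rintro s t ⟨V₁, hV₁, hs, Δ₁, hfin₁, hsub₁, h₁⟩ ⟨V₂, hV₂, ht, Δ₂, hfin₂, hsub₂, h₂⟩
      refine ⟨V₁ ∪ V₂, hV₁.union hV₂, union_subset_union hs ht, Δ₁ ∪ Δ₂, hfin₁.union hfin₂,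
        union_subset hsub₁ hsub₂, ?_⟩
      rw [union_inter_distrib_right, translates, biUnion_union]
      exact union_subset_union h₁ h₂
    · intro x hx
      obtain ⟨γ, hγ, hxγ⟩ := ha k x (hFK hx)
      -- If `γ x = δ d` with `d ∈ D`, three factors lead from x to d by `hcon`, and a fourth from d
      -- to `δ d`, contradicting the choice of γ.
      have hfar : γ x ∉ translates Δ D := by
        intro hmem
        obtain ⟨δ, hδ, d, hd, hdx⟩ := mem_translates.1 hmem
        have hd' : d = (δ⁻¹ * γ) x := by
          rw [Homeomorph.mul_apply, ← hdx]
          exact (δ.symm_apply_apply d).symm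
        have hδγ : δ⁻¹ * γ ∈ Γ := Γ.mul_mem (Γ.inv_mem (hΔΓ hδ)) hγ
        obtain ⟨b, ⟨c, h1, h2⟩, h3⟩ := hcon x hx _ hδγ (hd' ▸ hd)
        refine hxγ ⟨d, ⟨b, ⟨c, hRmono hmk h1, hRmono hmk h2⟩, hd' ▸ hRmono hmk h3⟩, ?_⟩
        rw [← hdx, hd']
        exact hk δ hδ _ (apply_mem_translates hδγ (subset_translates Γ K (hFK hx)))
      have hopen : IsOpen (γ ⁻¹' (translates Δ D)ᶜ) :=
        (isClosed_translates hΔ hD).isOpen_compl.preimage γ.continuous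
      refine ⟨γ ⁻¹' (translates Δ D)ᶜ, mem_nhdsWithin_of_mem_nhds (hopen.mem_nhds hfar), _, hopen,
        Subset.rfl, (fun δ => γ⁻¹ * δ) '' Δ, hΔ.image _, ?_, ?_⟩
      · rintro _ ⟨δ, hδ, rfl⟩
        exact Γ.mul_mem (Γ.inv_mem hγ) (hΔΓ hδ)
      -- Since `γ y` avoids `Δ · V`, the cover of Y must catch it in `Δ · U`.
      · rintro y ⟨hy, hyY⟩
        have hmem := hYΔ (hYmem γ hγ y hyY)
        rw [translates_union] at hmem
        rcases hmem with hmem | hmem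
        · exact absurd (biUnion_mono Subset.rfl (fun δ _ => image_mono hVD) hmem) hy
        · obtain ⟨δ, hδ, u, hu, huy⟩ := mem_translates.1 hmem
          refine mem_translates.2 ⟨_, mem_image_of_mem _ hδ, u, hu, ?_⟩
          rw [Homeomorph.mul_apply, huy]
          exact γ.symm_apply_apply y
  obtain ⟨V', hV', hFV', Δ', hΔ', hΔ'Γ, hV'Y⟩ := key
  -- Cover Y again, now by translates of `V' ∪ U`, and replace `V' ∩ Y` by its cover with translates
  -- of `U`.
  obtain ⟨Δ₂, hΔ₂, hΔ₂Γ, hYΔ₂⟩ := cover V' hV' hFV'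
  refine hU.2 ⟨image2 (· * ·) Δ₂ Δ' ∪ Δ₂, (hΔ₂.image2 _ hΔ').union hΔ₂, ?_, ?_⟩
  · refine union_subset ?_ hΔ₂Γ
    rintro _ ⟨δ, hδ, δ', hδ', rfl⟩
    exact Γ.mul_mem (hΔ₂Γ hδ) (hΔ'Γ hδ')
  · intro y hy
    obtain ⟨δ, hδ, v, hv, rfl⟩ := mem_translates.1 (hYΔ₂ hy)
    rcases hv with hv | hv
    · have hvY : v ∈ Y := by
        have := hYmem _ (Γ.inv_mem (hΔ₂Γ hδ)) _ hy
        rwa [← Homeomorph.mul_apply, inv_mul_cancel] at this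
      obtain ⟨δ', hδ', u, hu, rfl⟩ := mem_translates.1 (hV'Y ⟨hv, hvY⟩)
      exact mem_translates.2 ⟨δ * δ', Or.inl (mem_image2_of_mem hδ hδ'), u, hu, rfl⟩
    · exact mem_translates.2 ⟨δ, Or.inr hδ, v, hv, rfl⟩

/-- One splitting of the scheme. The points near x that no γ moves suitably form a set in the ideal;
a support point z of what remains has a suitable γ, and continuity with regularity extends the
property to a neighbourhood of z. -/
theorem IsSupportPoint.exists_far_translate [RegularSpace X] {Γ : Subgroup (X ≃ₜ X)} {Y : Set X}
    (hY : ∀ γ ∈ Γ, γ '' Y = Y)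
    {R : ℕ → SetRel X X} (hRmono : Monotone R) (hRsymm : ∀ n, (R n).IsSymm)
    (hRclosed : ∀ n, IsClosed (R n)) {K : Set X} (hK : IsCompact K)
    (ha : ∀ n, ∀ x ∈ K, ∃ γ ∈ Γ, (x, γ x) ∉ R n ○ R n ○ R n ○ R n)
    (hb : ∀ γ ∈ Γ, ∃ n, ∀ x ∈ translates (Γ : Set (X ≃ₜ X)) K, (x, γ x) ∈ R n)
    {x : X} (hx : IsSupportPoint (nonCovering Γ Y) K x) {W : Set X} (hW : IsOpen W) (hxW : x ∈ W)
    {S : Set (X ≃ₜ X)} (hS : S.Finite) (hSΓ : S ⊆ Γ) (n : ℕ) :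
    ∃ γ ∈ Γ, ∃ z ∈ K, IsSupportPoint (nonCovering Γ Y) K z ∧ ∃ O, IsOpen O ∧ z ∈ O ∧
      closure O ⊆ W ∧ γ '' closure O ⊆ W ∧ ∀ u ∈ O, ∀ v ∈ O, ∀ s ∈ S, ∀ t ∈ S,
        (s u, t (γ v)) ∉ R n := by
  obtain ⟨D, hDx, hD, hDW⟩ := exists_mem_nhds_isClosed_subset (hW.mem_nhds hxW)
  obtain ⟨C, hCx, hC, hCD⟩ := exists_mem_nhds_isClosed_subset (interior_mem_nhds.2 hDx)
  set 𝒰 := nonCovering Γ Y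
  have hFpos : K ∩ C ∉ associatedIdeal 𝒰 := fun h =>
    hx _ isOpen_interior (mem_interior_iff_mem_nhds.2 hCx)
      (associatedIdeal_mono (inter_subset_inter_right _ interior_subset) h)
  obtain ⟨m, hnm, hm⟩ := exists_uniform_bound hRmono hb hS hSΓ n
  let O : (X ≃ₜ X) → Set X := fun γ =>
    γ ⁻¹' W ∩ ⋂ s ∈ S, ⋂ t ∈ S, (fun z => (s z, t (γ z))) ⁻¹' (R n)ᶜ
  have hO : ∀ γ, IsOpen (O γ) := fun γ =>
    (hW.preimage γ.continuous).inter <| hS.isOpen_biInter fun s _ => hS.isOpen_biInter fun t _ =>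
      (hRclosed n).isOpen_compl.preimage
        (s.continuous.prodMk (t.continuous.comp γ.continuous))
  -- Were this compact set positive, some point z of it would have `(z, γ z)` outside the triple
  -- composition. The path from z to `s z` to `t (γ z)` to `γ z` then shows that the middle step is
  -- not in `R n`, so z lies in `O γ`.
  have hA : (K ∩ C) \ ⋃ γ ∈ Γ, O γ ∈ associatedIdeal 𝒰 := by
    by_contra hpos
    have hOo : IsOpen (⋃ γ ∈ Γ, O γ) := isOpen_biUnion fun γ _ => hO γ
    obtain ⟨z, hz, γ, hγ, hzD, hzR⟩ := _root_.exists_far_translate hY hRmono ha hb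
      ((hK.inter_right hC).diff hOo) (sdiff_subset.trans inter_subset_left) hpos isOpen_interior
      (sdiff_subset.trans (inter_subset_right.trans hCD)) hD interior_subset m
    refine hz.2 (mem_biUnion hγ ⟨hDW hzD, ?_⟩)
    simp only [mem_iInter, mem_preimage, mem_compl_iff]
    intro s hs t ht hst
    have hzK := subset_translates Γ K hz.1.1
    exact hzR ⟨t (γ z), ⟨s z, hm s hs z hzK, hRmono hnm hst⟩,
      (hRsymm m).symm _ _ (hm t ht _ (apply_mem_translates hγ hzK))⟩
  obtain ⟨V₁, hV₁, hAV₁, hpos⟩ := exists_open_diff_notMem_associatedIdeal hFpos hA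
  obtain ⟨z, hz, hzs⟩ := exists_isSupportPoint ((hK.inter_right hC).diff hV₁) hpos
  have hzO : z ∈ ⋃ γ ∈ Γ, O γ := by
    by_contra h
    exact hz.2 (hAV₁ ⟨hz.1, h⟩)
  obtain ⟨γ, hγ, hzγ⟩ := mem_iUnion₂.1 hzO
  have hzK : z ∈ K := hz.1.1
  have hzW : z ∈ W := hDW (interior_subset (hCD hz.1.2))
  -- Separation holds at the pair `(z, z)`; closedness of `R n` spreads it to independent u and v
  -- near z.
  have hnhds : ∀ᶠ p : X × X in 𝓝 (z, z), ∀ s ∈ S, ∀ t ∈ S, (s p.1, t (γ p.2)) ∉ R n := by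
    rw [Filter.eventually_all_finite hS]
    intro s hs
    rw [Filter.eventually_all_finite hS]
    intro t ht
    have hc : Continuous fun p : X × X => (s p.1, t (γ p.2)) := by fun_prop
    have hmem := hzγ.2
    simp only [mem_iInter] at hmem
    exact (hc.tendsto (z, z)).eventually ((hRclosed n).isOpen_compl.mem_nhds (hmem s hs t ht))
  rw [nhds_prod_eq, Filter.eventually_prod_self_iff'] at hnhds
  obtain ⟨T, hT, hTR⟩ := hnhds
  have hbig : T ∩ (W ∩ γ ⁻¹' W) ∈ 𝓝 z := Filter.inter_mem hT
    ((hW.inter (hW.preimage γ.continuous)).mem_nhds ⟨hzW, hzγ.1⟩)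
  obtain ⟨E, hEz, hE, hEsub⟩ := exists_mem_nhds_isClosed_subset hbig
  have hcl : closure (interior E) ⊆ E := closure_minimal interior_subset hE
  refine ⟨γ, hγ, z, hzK, hzs.mono (sdiff_subset.trans inter_subset_left), interior E,
    isOpen_interior, mem_interior_iff_mem_nhds.2 hEz, fun u hu => (hEsub (hcl hu)).2.1, ?_, ?_⟩
  · rintro _ ⟨u, hu, rfl⟩
    exact (hEsub (hcl hu)).2.2
  · intro u hu v hv
    exact hTR u (hEsub (interior_subset hu)).1 v (hEsub (interior_subset hv)).1

end Translates
-- Dependent choice, finite dependence and eventual equality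
/-- Dependent choice for a requirement `P n` that concerns the first `n + 1` terms only. -/
theorem exists_seq_of_local_step {α : Type*} [Nonempty α] {P : ℕ → (ℕ → α) → Prop}
    (hloc : ∀ n a b, (∀ k ≤ n, a k = b k) → P n a → P n b)
    (hstep : ∀ n a, (∀ k < n, P k a) → ∃ v, P n (Function.update a n v)) :
    ∃ a, ∀ n, P n a := by
  choose! v hv using hstep
  let A : ℕ → ℕ → α := fun n =>
    Nat.rec (fun _ => Classical.arbitrary α) (fun n a => Function.update a n (v n a)) n
  have hA : ∀ n, A (n + 1) = Function.update (A n) n (v n (A n)) := fun n => rfl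
  have hP : ∀ n, ∀ k < n, P k (A n) := by
    intro n
    induction n with
    | zero => intro k hk; omega
    | succ n ih =>
      intro k hk
      rcases Nat.lt_succ_iff_lt_or_eq.1 hk with hk | rfl
      · refine hloc k (A n) _ (fun j hj => ?_) (ih k hk)
        rw [hA, Function.update_of_ne (by omega)]
      · rw [hA]
        exact hv k _ ih
  have hstable : ∀ k n, k + 1 ≤ n → A n k = A (k + 1) k := by
    intro k n hn
    induction n, hn using Nat.le_induction with
    | base => rfl
    | succ n hn ih => rw [hA, Function.update_of_ne (by omega), ih]
  -- Term n is final from stage `n + 1` on; the values of `A n` from n onwards are placeholders.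
  exact ⟨fun n => A (n + 1) n, fun n =>
    hloc n (A (n + 1)) _ (fun k hk => hstable k (n + 1) (by omega)) (hP (n + 1) n n.lt_succ_self)⟩

theorem IsCompact.inter_iInter_nonempty_of_antitone {X : Type*} [TopologicalSpace X] {K : Set X}
    (hK : IsCompact K) {t : ℕ → Set X} (ht : Antitone t) (hcl : ∀ n, IsClosed (t n))
    (hne : ∀ n, (K ∩ t n).Nonempty) : (K ∩ ⋂ n, t n).Nonempty := by
  refine hK.inter_iInter_nonempty t hcl fun u => ?_
  obtain ⟨N, hN⟩ := u.bddAbove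
  exact (hne N).mono (inter_subset_inter_right _ (subset_iInter₂ fun n hn => ht (hN hn)))

/-- A map on the Cantor space that depends on finitely many coordinates has finite range. -/
theorem finite_range_of_local {β : Type*} {f : (ℕ → Bool) → β} (n : ℕ)
    (hf : ∀ y z, (∀ k < n, y k = z k) → f y = f z) : (range f).Finite := by
  refine (finite_range fun w : Fin n → Bool =>
    f fun k => if h : k < n then w ⟨k, h⟩ else false).subset ?_
  rintro _ ⟨y, rfl⟩
  exact ⟨fun k => y k, hf _ _ fun k hk => by simp [hk]⟩

theorem ChoquetStrategy.response_congr {X : Type*} [TopologicalSpace X] (σ : ChoquetStrategy X)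
    {a b : ℕ → TopologicalSpace.Opens X × X} {n : ℕ} (h : ∀ k ≤ n, a k = b k) :
    σ.response a n = σ.response b n := by
  unfold ChoquetStrategy.response
  congr 1
  exact List.map_congr_left fun k hk => h k (Nat.lt_succ_iff.1 (List.mem_range.1 hk))

theorem EZero.symm {y z : ℕ → Bool} (h : EZero y z) : EZero z y := by
  obtain ⟨n, hn⟩ := h
  exact ⟨n, fun m hm => (hn m hm).symm⟩

theorem EZero.trans {x y z : ℕ → Bool} (h : EZero x y) (h' : EZero y z) : EZero x z := by
  obtain ⟨n, hn⟩ := h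
  obtain ⟨m, hm⟩ := h'
  exact ⟨max n m, fun k hk =>
    (hn k (lt_of_le_of_lt (le_max_left _ _) hk)).trans (hm k (lt_of_le_of_lt (le_max_right _ _) hk))⟩

/-- Eventual equality as a setoid. -/
def eZeroSetoid : Setoid (ℕ → Bool) where
  r := EZero
  iseqv := ⟨fun _ => ⟨0, fun _ _ => rfl⟩, EZero.symm, EZero.trans⟩

/-! ### The Cantor scheme -/

section Scheme

variable {X : Type*} [TopologicalSpace X]

/-- Choose one representative per class and carry its chosen point to the other members; equivalent
y and z then start from the same point. -/
theorem exists_equivariant_selection {Γ : Subgroup (X ≃ₜ X)} {φ : (ℕ → Bool) → Set X}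
    (hne : ∀ y, (φ y).Nonempty) (hφ : ∀ y z, EZero z y → ∃ γ ∈ Γ, γ '' φ z = φ y) :
    ∃ f : (ℕ → Bool) → X, (∀ y, f y ∈ φ y) ∧ ∀ y z, EZero z y → ∃ γ ∈ Γ, γ (f z) = f y := by
  choose p hp using hne
  let q : (ℕ → Bool) → ℕ → Bool := fun y => (Quotient.mk eZeroSetoid y).out
  have hq : ∀ y, EZero (q y) y := fun y => Quotient.exact (s := eZeroSetoid) (Quotient.out_eq _)
  choose g hg hgφ using fun y => hφ y (q y) (hq y)
  refine ⟨fun y => g y (p (q y)), fun y => hgφ y ▸ mem_image_of_mem _ (hp _), ?_⟩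
  intro y z hzy
  have hqq : q z = q y := congrArg Quotient.out (Quotient.sound (s := eZeroSetoid) hzy)
  refine ⟨g y * (g z)⁻¹, Γ.mul_mem (hg y) (Γ.inv_mem (hg z)), ?_⟩
  rw [← Homeomorph.mul_apply, inv_mul_cancel_right, hqq]

/-- The product of the elements `γ (k + 1)` over those `k < n` with `y k = true`. -/
def branchProd (γ : ℕ → X ≃ₜ X) : ℕ → (ℕ → Bool) → X ≃ₜ X
  | 0, _ => 1
  | n + 1, y => branchProd γ n y * if y n then γ (n + 1) else 1

theorem branchProd_congr {γ γ' : ℕ → X ≃ₜ X} {y z : ℕ → Bool} {n : ℕ}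
    (hγ : ∀ k ≤ n, γ k = γ' k) (hyz : ∀ k < n, y k = z k) :
    branchProd γ n y = branchProd γ' n z := by
  induction n with
  | zero => rfl
  | succ n ih =>
    simp only [branchProd]
    rw [ih (fun k hk => hγ k (by omega)) (fun k hk => hyz k (by omega)), hγ (n + 1) le_rfl,
      hyz n (by omega)]

theorem branchProd_mem {Γ : Subgroup (X ≃ₜ X)} {γ : ℕ → X ≃ₜ X} {n : ℕ} (hγ : ∀ k ≤ n, γ k ∈ Γ)
    (y : ℕ → Bool) : branchProd γ n y ∈ Γ := by
  induction n with
  | zero => exact Γ.one_mem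
  | succ n ih =>
    refine Γ.mul_mem (ih fun k hk => hγ k (by omega)) ?_
    split_ifs
    exacts [hγ _ le_rfl, Γ.one_mem]

theorem branchProd_zero_branch (γ : ℕ → X ≃ₜ X) (n : ℕ) :
    branchProd γ n (fun _ => false) = 1 := by
  induction n with
  | zero => rfl
  | succ n ih => simp [branchProd, ih]

theorem branchProd_eq_mul_of_agree (γ : ℕ → X ≃ₜ X) {y z : ℕ → Bool} {N : ℕ}
    (h : ∀ m, N ≤ m → z m = y m) {n : ℕ} (hn : N ≤ n) :
    branchProd γ n y = branchProd γ N y * (branchProd γ N z)⁻¹ * branchProd γ n z := by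
  induction n, hn using Nat.le_induction with
  | base => rw [inv_mul_cancel_right]
  | succ n hn ih =>
    simp only [branchProd]
    rw [h n hn, ih]
    simp only [mul_assoc]

/-- The move of player A along the branch `y` in round `n`: the translate of the pair
`(U n, x n)`. -/
def branchMove (a : ℕ → TopologicalSpace.Opens X × X × (X ≃ₜ X)) (y : ℕ → Bool) (n : ℕ) :
    TopologicalSpace.Opens X × X :=
  (⟨branchProd (fun k => (a k).2.2) n y '' (a n).1,
      (branchProd (fun k => (a k).2.2) n y).isOpenMap _ (a n).1.isOpen⟩,
    branchProd (fun k => (a k).2.2) n y (a n).2.1)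

theorem branchMove_congr {a b : ℕ → TopologicalSpace.Opens X × X × (X ≃ₜ X)} {y z : ℕ → Bool}
    {n : ℕ} (hab : ∀ k ≤ n, a k = b k) (hyz : ∀ k < n, y k = z k) :
    branchMove a y n = branchMove b z n := by
  have h := branchProd_congr (γ := fun k => (a k).2.2) (γ' := fun k => (b k).2.2)
    (fun k hk => by rw [hab k hk]) hyz
  simp only [branchMove, h, hab n le_rfl]

/-- The requirement on round `n` of the construction of the Cantor scheme. -/
structure SchemeStep (σ : ChoquetStrategy X) (Γ : Subgroup (X ≃ₜ X)) (R : ℕ → SetRel X X)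
    (𝒰 : Set (Set X)) (K : Set X) (n : ℕ)
    (a : ℕ → TopologicalSpace.Opens X × X × (X ≃ₜ X)) : Prop where
  mem_compact : (a n).2.1 ∈ K
  support : IsSupportPoint 𝒰 K (a n).2.1
  mem_open : (a n).2.1 ∈ (a n).1
  mem_group : (a n).2.2 ∈ Γ
  closure_subset : ∀ m, m + 1 = n → ∀ y,
    branchProd (fun k => (a k).2.2) n y '' closure (a n).1 ⊆ σ.response (branchMove a y) m
  separated : ∀ m, m + 1 = n → ∀ y z, y m ≠ z m → ∀ u ∈ (a n).1, ∀ v ∈ (a n).1,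
    (branchProd (fun k => (a k).2.2) n y u, branchProd (fun k => (a k).2.2) n z v) ∉ R m

theorem SchemeStep.congr {σ : ChoquetStrategy X} {Γ : Subgroup (X ≃ₜ X)} {R : ℕ → SetRel X X}
    {𝒰 : Set (Set X)} {K : Set X} {n : ℕ} {a b : ℕ → TopologicalSpace.Opens X × X × (X ≃ₜ X)}
    (hab : ∀ k ≤ n, a k = b k) (h : SchemeStep σ Γ R 𝒰 K n a) : SchemeStep σ Γ R 𝒰 K n b := by
  have hn := hab n le_rfl
  have hprod : ∀ y, branchProd (fun k => (a k).2.2) n y = branchProd (fun k => (b k).2.2) n y :=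
    fun y => branchProd_congr (fun k hk => by rw [hab k hk]) fun _ _ => rfl
  refine ⟨hn ▸ h.mem_compact, hn ▸ h.support, hn ▸ h.mem_open, hn ▸ h.mem_group, ?_, ?_⟩
  · intro m hm y
    have := h.closure_subset m hm y
    rwa [hprod, hn, σ.response_congr fun k hk =>
      branchMove_congr (z := y) (fun j hj => hab j (by omega)) fun _ _ => rfl] at this
  · intro m hm y z hyz u hu v hv
    rw [← hprod, ← hprod]
    exact h.separated m hm y z hyz u (hn ▸ hu) v (hn ▸ hv)

theorem SchemeStep.legalA {σ : ChoquetStrategy X} {Γ : Subgroup (X ≃ₜ X)} {R : ℕ → SetRel X X}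
    {𝒰 : Set (Set X)} {K : Set X} {n : ℕ} {a : ℕ → TopologicalSpace.Opens X × X × (X ≃ₜ X)}
    (h : SchemeStep σ Γ R 𝒰 K n a) (y : ℕ → Bool) : σ.LegalA (branchMove a y) n :=
  ⟨mem_image_of_mem _ h.mem_open, fun m hm =>
    (image_mono subset_closure).trans (h.closure_subset m hm y)⟩

/-- Finitely many partial games are run at once. All of B's answers are pulled back to
neighbourhoods of the single point `x m`, where one splitting serves every branch. -/
theorem exists_schemeStep_succ [RegularSpace X] {σ : ChoquetStrategy X} (hσ : σ.IsWinning)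
    {Γ : Subgroup (X ≃ₜ X)} {Y : Set X}
    (hY : ∀ γ ∈ Γ, γ '' Y = Y)
    {R : ℕ → SetRel X X} (hRmono : Monotone R) (hRsymm : ∀ n, (R n).IsSymm)
    (hRclosed : ∀ n, IsClosed (R n)) {K : Set X} (hK : IsCompact K)
    (ha : ∀ n, ∀ x ∈ K, ∃ γ ∈ Γ, (x, γ x) ∉ R n ○ R n ○ R n ○ R n)
    (hb : ∀ γ ∈ Γ, ∃ n, ∀ x ∈ translates (Γ : Set (X ≃ₜ X)) K, (x, γ x) ∈ R n)
    {m : ℕ} {a : ℕ → TopologicalSpace.Opens X × X × (X ≃ₜ X)}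
    (h : ∀ k < m + 1, SchemeStep σ Γ R (nonCovering Γ Y) K k a) :
    ∃ v, SchemeStep σ Γ R (nonCovering Γ Y) K (m + 1) (Function.update a (m + 1) v) := by
  set G := branchProd (fun k => (a k).2.2) m with hG
  have hlegal : ∀ y, σ.LegalB (branchMove a y) m := fun y =>
    (hσ _).1 m fun k hk => (h k (by omega)).legalA y
  have hlocG : ∀ y z : ℕ → Bool, (∀ k < m, y k = z k) → G y = G z := fun y z hyz =>
    branchProd_congr (fun _ _ => rfl) hyz
  -- Only the first m coordinates matter, so the intersection of these sets is still open.
  let B : (ℕ → Bool) → Set X := fun y => G y ⁻¹' σ.response (branchMove a y) m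
  have hB : (range B).Finite := by
    refine finite_range_of_local m fun y z hyz => ?_
    have hres : σ.response (branchMove a y) m = σ.response (branchMove a z) m :=
      σ.response_congr fun k hk => branchMove_congr (fun _ _ => rfl) fun j hj => hyz j (by omega)
    simp only [B, hlocG y z hyz, hres]
  have hW : IsOpen (⋂₀ range B) := by
    refine hB.isOpen_sInter ?_
    rintro _ ⟨y, rfl⟩
    exact (σ.response (branchMove a y) m).isOpen.preimage (G y).continuous
  have hxW : (a m).2.1 ∈ ⋂₀ range B := by
    rintro _ ⟨y, rfl⟩
    exact (hlegal y).1
  obtain ⟨γ, hγ, z, hzK, hz, O, hO, hzO, hOW, hγOW, hsep⟩ :=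
    (h m m.lt_succ_self).support.exists_far_translate hY hRmono hRsymm hRclosed hK ha hb hW hxW
      (finite_range_of_local m hlocG) (by
        rintro _ ⟨y, rfl⟩
        exact branchProd_mem (fun k hk => (h k (by omega)).mem_group) y) m
  refine ⟨(⟨O, hO⟩, z, γ), ?_⟩
  set b := Function.update a (m + 1) (⟨O, hO⟩, z, γ) with hbdef
  have hbm : b (m + 1) = (⟨O, hO⟩, z, γ) := Function.update_self _ _ _
  have hab : ∀ k ≤ m, b k = a k := fun k hk => Function.update_of_ne (by omega) _ _
  have hprod : ∀ y, branchProd (fun k => (b k).2.2) (m + 1) y = G y * if y m then γ else 1 := by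
    intro y
    rw [branchProd, branchProd_congr (γ' := fun k => (a k).2.2) (z := y)
      (fun k hk => by rw [hab k hk]) fun _ _ => rfl, hbm]
  have hres : ∀ y, σ.response (branchMove b y) m = σ.response (branchMove a y) m := fun y =>
    σ.response_congr fun k hk => branchMove_congr (fun j hj => hab j (by omega)) fun _ _ => rfl
  refine ⟨by rwa [hbm], by rwa [hbm], by rwa [hbm], by rwa [hbm], ?_, ?_⟩
  · intro m' hm' y
    obtain rfl : m' = m := by omega
    rw [hprod, hbm, hres]
    rintro _ ⟨u, hu, rfl⟩
    rw [Homeomorph.mul_apply]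
    split_ifs
    · exact hγOW (mem_image_of_mem _ hu) _ ⟨y, rfl⟩
    · exact hOW hu _ ⟨y, rfl⟩
  · intro m' hm' y z hyz u hu v hv
    obtain rfl : m' = m := by omega
    rw [hbm] at hu hv
    rw [hprod, hprod, Homeomorph.mul_apply, Homeomorph.mul_apply]
    cases hy : y m' <;> cases hz : z m'
    · exact absurd (hy.trans hz.symm) hyz
    · exact hsep u hu v hv _ ⟨y, rfl⟩ _ ⟨z, rfl⟩
    · exact fun hR => hsep v hv u hu _ ⟨z, rfl⟩ _ ⟨y, rfl⟩ ((hRsymm m').symm _ _ hR)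
    · exact absurd (hy.trans hz.symm) hyz

theorem exists_scheme [RegularSpace X] {σ : ChoquetStrategy X} (hσ : σ.IsWinning)
    {Γ : Subgroup (X ≃ₜ X)} {Y : Set X}
    (hY : ∀ γ ∈ Γ, γ '' Y = Y)
    {R : ℕ → SetRel X X} (hRmono : Monotone R) (hRsymm : ∀ n, (R n).IsSymm)
    (hRclosed : ∀ n, IsClosed (R n)) {K : Set X} (hK : IsCompact K)
    (hKpos : K ∉ associatedIdeal (nonCovering Γ Y))
    (ha : ∀ n, ∀ x ∈ K, ∃ γ ∈ Γ, (x, γ x) ∉ R n ○ R n ○ R n ○ R n)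
    (hb : ∀ γ ∈ Γ, ∃ n, ∀ x ∈ translates (Γ : Set (X ≃ₜ X)) K, (x, γ x) ∈ R n) :
    ∃ a, ∀ n, SchemeStep σ Γ R (nonCovering Γ Y) K n a := by
  obtain ⟨x, hxK, hx⟩ := exists_isSupportPoint hK hKpos
  have : Nonempty (TopologicalSpace.Opens X × X × (X ≃ₜ X)) := ⟨(⊤, x, 1)⟩
  refine exists_seq_of_local_step (fun n a b hab h => h.congr hab) fun n a h => ?_
  cases n with
  | zero =>
    refine ⟨(⊤, x, 1), ?_⟩
    have hx0 : Function.update a 0 (⊤, x, 1) 0 = (⊤, x, 1) := Function.update_self _ _ _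
    exact ⟨by rwa [hx0], by rwa [hx0], by rw [hx0]; trivial, by rw [hx0]; exact Γ.one_mem,
      fun m hm => absurd hm m.succ_ne_zero, fun m hm => absurd hm m.succ_ne_zero⟩
  | succ m => exact exists_schemeStep_succ hσ hY hRmono hRsymm hRclosed hK ha hb h

end Scheme

/-! ### The main theorem -/

theorem theorem2p8 {X : Type*} [TopologicalSpace X] [RegularSpace X]
    (hX : IsStrongChoquet X)
    (Γ : Subgroup (X ≃ₜ X))
    (Y : Set X) (hY : ∀ γ ∈ Γ, γ '' Y = Y)
    (R : ℕ → SetRel X X) (hRmono : Monotone R)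
    (hRrefl : ∀ n, (R n).IsRefl) (hRsymm : ∀ n, (R n).IsSymm)
    (hRclosed : ∀ n, IsClosed (R n))
    (K : Set X) (hKcompact : IsCompact K)
    (hKpos : K ∉ associatedIdeal (nonCovering Γ Y))
    (ha : ∀ n, ∀ x ∈ K, ∃ γ ∈ Γ, (x, γ x) ∉ R n ○ R n ○ R n ○ R n)
    (hb : ∀ γ ∈ Γ, ∃ n, ∀ x ∈ translates (Γ : Set (X ≃ₜ X)) K, (x, γ x) ∈ R n) :
    -- the set-valued map
    ∃ φ : (ℕ → Bool) → Set X,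
      (∀ y, (φ y).Nonempty ∧ IsClosed (φ y) ∧ IsGδ (φ y)) ∧
      (∀ y z, EZero z y → ∃ γ ∈ Γ, γ '' φ z = φ y) ∧
      (∀ y z, ¬ EZero z y → φ y ×ˢ φ z ⊆ (⋃ n, R n)ᶜ) ∧
      -- the resulting homomorphism into `X`
      (∃ f : (ℕ → Bool) → X,
        (∀ y, f y ∈ φ y) ∧
        (∀ y z, EZero z y → ∃ γ ∈ Γ, γ (f z) = f y) ∧
        (∀ y z, ¬ EZero z y → (f y, f z) ∉ ⋃ n, R n)) ∧
      -- the compact case: both maps can be taken inside the closure of `Γ · x`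
      (CompactSpace X → ∃ x ∈ K,
        (∃ ψ : (ℕ → Bool) → Set X,
          (∀ y, (ψ y).Nonempty ∧ IsClosed (ψ y) ∧
            ψ y = φ y ∩ closure (translates (Γ : Set (X ≃ₜ X)) {x})) ∧
          (∀ y z, EZero z y → ∃ γ ∈ Γ, γ '' ψ z = ψ y) ∧
          (∀ y z, ¬ EZero z y → ψ y ×ˢ ψ z ⊆ (⋃ n, R n)ᶜ)) ∧
        (∃ f : (ℕ → Bool) → X,
          (∀ y, f y ∈ closure (translates (Γ : Set (X ≃ₜ X)) {x})) ∧
          (∀ y z, EZero z y → ∃ γ ∈ Γ, γ (f z) = f y) ∧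
          (∀ y z, ¬ EZero z y → (f y, f z) ∉ ⋃ n, R n))) := by
  obtain ⟨σ, hσ⟩ := hX
  obtain ⟨a, hstep⟩ := exists_scheme hσ hY hRmono hRsymm hRclosed hKcompact hKpos ha hb
  set U : ℕ → TopologicalSpace.Opens X := fun n => (a n).1
  set G := branchProd (fun k => (a k).2.2)
  have hGΓ : ∀ n y, G n y ∈ Γ := fun n y => branchProd_mem (fun k _ => (hstep k).mem_group) y
  have hB : ∀ y n, σ.LegalB (branchMove a y) n := fun y n =>
    (hσ _).1 n fun k _ => (hstep k).legalA y
  have hresU : ∀ y n, (σ.response (branchMove a y) n : Set X) ⊆ G n y '' U n :=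
    fun y n => (hB y n).2
  have hclres : ∀ y n, G (n + 1) y '' closure (U (n + 1)) ⊆ σ.response (branchMove a y) n :=
    fun y n => (hstep (n + 1)).closure_subset n rfl y
  have hclU : ∀ y n, G (n + 1) y '' closure (U (n + 1)) ⊆ G n y '' U n :=
    fun y n => (hclres y n).trans (hresU y n)
  have hanti : ∀ y, Antitone fun n => G n y '' (U n : Set X) := fun y =>
    antitone_nat_of_succ_le fun n => (image_mono subset_closure).trans (hclU y n)
  let φ : (ℕ → Bool) → Set X := fun y => ⋂ n, G n y '' (U n : Set X)
  have hφcl : ∀ y, φ y = ⋂ n, G n y '' closure (U n) := fun y =>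
    (iInter_mono fun n => image_mono subset_closure).antisymm <| subset_iInter fun n =>
      (iInter_subset _ (n + 1)).trans (hclU y n)
  have hclosed : ∀ y, IsClosed (φ y) := fun y => by
    rw [hφcl]
    exact isClosed_iInter fun n => (G n y).isClosedMap _ isClosed_closure
  have hne : ∀ y, (φ y).Nonempty := fun y =>
    ((hσ (branchMove a y)).2 fun n => (hstep n).legalA y).mono (iInter_mono (hresU y))
  have hequiv : ∀ y z, EZero z y → ∃ γ ∈ Γ, γ '' φ z = φ y := by
    rintro y z ⟨N, hN⟩
    -- `EZero` gives agreement strictly beyond N, hence `N + 1`.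
    refine ⟨G (N + 1) y * (G (N + 1) z)⁻¹, Γ.mul_mem (hGΓ _ _) (Γ.inv_mem (hGΓ _ _)), ?_⟩
    have htail : ∀ y, φ y = ⋂ n, G (n + (N + 1)) y '' (U (n + (N + 1)) : Set X) := fun y =>
      ((hanti y).iInter_nat_add (N + 1)).symm
    rw [htail, htail, image_iInter (Homeomorph.bijective _)]
    refine iInter_congr fun n => ?_
    have hmul : G (n + (N + 1)) y = G (N + 1) y * (G (N + 1) z)⁻¹ * G (n + (N + 1)) z :=
      branchProd_eq_mul_of_agree _ (fun m hm => hN m (by omega)) (by omega)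
    rw [hmul, ← image_comp]
    rfl
  have hsep : ∀ y z, ¬ EZero z y → φ y ×ˢ φ z ⊆ (⋃ n, R n)ᶜ := by
    rintro y z hyz ⟨p, q⟩ ⟨hp, hq⟩ hpq
    obtain ⟨n, hn⟩ := mem_iUnion.1 hpq
    simp only [EZero, not_exists, not_forall] at hyz
    obtain ⟨m, hnm, hm⟩ := hyz n
    obtain ⟨u, hu, rfl⟩ := mem_iInter.1 hp (m + 1)
    obtain ⟨v, hv, rfl⟩ := mem_iInter.1 hq (m + 1)
    exact (hstep (m + 1)).separated m rfl y z (Ne.symm hm) u hu v hv (hRmono hnm.le hn)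
  have hsel : ∀ ψ : (ℕ → Bool) → Set X, (∀ y, (ψ y).Nonempty) → (∀ y, ψ y ⊆ φ y) →
      (∀ y z, EZero z y → ∃ γ ∈ Γ, γ '' ψ z = ψ y) → ∃ f : (ℕ → Bool) → X, (∀ y, f y ∈ ψ y) ∧
        (∀ y z, EZero z y → ∃ γ ∈ Γ, γ (f z) = f y) ∧
        ∀ y z, ¬ EZero z y → (f y, f z) ∉ ⋃ n, R n := fun ψ hψ hψφ hψe => by
    obtain ⟨f, hf, hfe⟩ := exists_equivariant_selection hψ hψe
    exact ⟨f, hf, hfe, fun y z hyz => hsep y z hyz ⟨hψφ y (hf y), hψφ z (hf z)⟩⟩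
  refine ⟨φ, fun y => ⟨hne y, hclosed y, ?_⟩, hequiv, hsep,
    hsel φ hne (fun _ => Subset.rfl) hequiv, fun hcompact => ?_⟩
  · exact .iInter_of_isOpen fun n => (G n y).isOpenMap _ (U n).isOpen
  -- Along the all-false branch every product is 1, so the untranslated sets are nested.
  have hUsucc : ∀ n, closure (U (n + 1) : Set X) ⊆ U n := fun n => by
    simpa [G, branchProd_zero_branch] using hclU (fun _ => false) n
  obtain ⟨x, hxK, hx⟩ := hKcompact.inter_iInter_nonempty_of_antitone
    (t := fun n => closure (U n : Set X))
    (antitone_nat_of_succ_le fun n => (hUsucc n).trans subset_closure)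
    (fun n => isClosed_closure)
    fun n => ⟨_, (hstep n).mem_compact, subset_closure (hstep n).mem_open⟩
  set C := closure (translates (Γ : Set (X ≃ₜ X)) {x})
  have hxC : ∀ γ ∈ Γ, γ x ∈ C := fun γ hγ =>
    subset_closure (mem_translates.2 ⟨γ, hγ, x, rfl, rfl⟩)
  have hψne : ∀ y, (φ y ∩ C).Nonempty := fun y => by
    have hC : IsCompact C := isClosed_closure.isCompact
    rw [inter_comm, hφcl]
    exact hC.inter_iInter_nonempty_of_antitone
      (antitone_nat_of_succ_le fun n => (hclU y n).trans (image_mono subset_closure))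
      (fun n => (G n y).isClosedMap _ isClosed_closure)
      -- As x lies in every `closure (U n)`, its translate `G n y x` is a point of the orbit in the
      -- n-th set of branch y; compactness of `C` does the rest.
      fun n => ⟨G n y x, hxC _ (hGΓ n y), mem_image_of_mem _ (mem_iInter.1 hx n)⟩
  have hψequiv : ∀ y z, EZero z y → ∃ γ ∈ Γ, γ '' (φ z ∩ C) = φ y ∩ C := fun y z hzy => by
    obtain ⟨γ, hγ, h⟩ := hequiv y z hzy
    exact ⟨γ, hγ, by rw [image_inter γ.injective, h, image_closure_translates hγ]⟩
  refine ⟨x, hxK, ⟨fun y => φ y ∩ C, fun y => ⟨hψne y, (hclosed y).inter isClosed_closure, rfl⟩,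
    hψequiv, fun y z hyz => (prod_mono inter_subset_left inter_subset_left).trans (hsep y z hyz)⟩,
    ?_⟩
  obtain ⟨f, hf, hfe, hfs⟩ := hsel (fun y => φ y ∩ C) hψne (fun y => inter_subset_left) hψequiv
  exact ⟨f, fun y => (hf y).2, hfe, hfs⟩
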